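/- **Proposition 4.3.** Let $n\ge 1$, let $\Lambda$ be an (almost surely) positive random variable, and let $\Lambda_1$ be an independent copy of $\Lambda$. Assume that $\mathbb{E}\big[(\Lambda+\Lambda_1)^{-n/2}\big]<\infty$. Put $V=\Lambda I_n$, and let $Z\sim N(0,I_n)$ be a standard Gaussian vector of $\mathbb{R}^n$ independent of $V$. Then $V^{1/2}Z$ has a density $f$ with respect to Lebesgue measure on $\mathbb{R}^n$, and $f\in L^2(\mathbb{R}^n)$. Moreover, the function $$I(t)=\int_{\mathbb{R}^n}\left[f(x)-\frac{1}{\sqrt{(2\pi)^n\det t}}\,e^{-\frac12 x^{*}t^{-1}x}\right]^2dx,$$ defined for real symmetric positive definite matrices $t$ of order $n$ (the square of the $L^2(\mathbb{R}^n)$ distance from $f$ to the density of $N(0,t)$), attains its minimum over the set of positive definite matrices at exactly one point $t_0$, and $t_0=cI_n$ for some real number $c>0$. -/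

import Mathlib

open MeasureTheory ProbabilityTheory
open scoped MatrixOrder Matrix

noncomputable section

/-- The random vector `X = V^{1/2} Z` of `ℝⁿ`, where `V` is a random positive (semi)definite matrix,
`V^{1/2}` is its positive square root, and `Z` is a random vector. -/
def mixtureVector {Ω : Type*} {n : ℕ} (V : Ω → Matrix (Fin n) (Fin n) ℝ)
    (Z : Ω → EuclideanSpace ℝ (Fin n)) : Ω → EuclideanSpace ℝ (Fin n) :=
  fun ω => Matrix.toEuclideanCLM (𝕜 := ℝ) (n := Fin n) (CFC.sqrt (V ω)) (Z ω)

/-- The real-valued (Lebesgue) probability density of a random vector `X` of `ℝⁿ`. -/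
def densityFun {Ω : Type*} [MeasurableSpace Ω] {n : ℕ} (P : Measure Ω)
    (X : Ω → EuclideanSpace ℝ (Fin n)) : EuclideanSpace ℝ (Fin n) → ℝ :=
  fun x => (pdf X P volume x).toReal

/-- The density `x ↦ ((2π)ⁿ det t)^{-1/2} exp (- x* t⁻¹ x / 2)` of the normal law `N(0, t)`
on `ℝⁿ`, for a positive definite matrix `t`. -/
def normalDensity {n : ℕ} (t : Matrix (Fin n) (Fin n) ℝ) (x : EuclideanSpace ℝ (Fin n)) : ℝ :=
  1 / Real.sqrt ((2 * Real.pi) ^ n * t.det) *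
    Real.exp (-(1 / 2) * ((x : Fin n → ℝ) ⬝ᵥ t⁻¹ *ᵥ (x : Fin n → ℝ)))

/-- The function `I(t) = ∫ (f(x) - φ_t(x))² dx`, where `φ_t` is the density of `N(0, t)`:
the square of the distance in `L²(ℝⁿ)` from `f` to `N(0, t)`. -/
def normalSqDist {n : ℕ} (f : EuclideanSpace ℝ (Fin n) → ℝ) (t : Matrix (Fin n) (Fin n) ℝ) : ℝ :=
  ∫ x : EuclideanSpace ℝ (Fin n), (f x - normalDensity t x) ^ 2

end

/-! Let `μ` be the law of `Λ`. Conditionally on `Λ = l` the vector is `N(0, l Iₙ)`, so `f` is the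
`μ`-mixture of these normal densities. The `L²` scalar product of the densities of `N(0, s)` and
`N(0, t)` is `((2π)ⁿ det (s + t))^{-1/2}` (`lintegral_normalDensity_mul`). Hence `‖f‖² = (2π)^{-n/2}
E (Λ + Λ₁)^{-n/2} < ∞`, and `I(t) = ‖f‖² + matrixCost μ t`.

Write `det t = gⁿ`. The term `‖φ_t‖²` depends on `g` only, while Minkowski's inequality `det (l Iₙ +
t) ≥ (l + g)ⁿ`, strict unless `t` is scalar, shows that the scalar product of `f` and `φ_t` is
largest at `t = g Iₙ`. So only scalar matrices compete.

On these, the derivative of the cost in `g` has the sign of `∫ (g / (l + g))^{n/2+1} dμ -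
2^{-n/2-1}`. The integral increases strictly from 0 to 1, so there is exactly one critical point,
and it is the strict minimum (`exists_isotropicCost_lt`). -/

/-! ### Gaussian integrals and `L²` scalar products of normal densities. -/

theorem lintegral_exp_neg_half_norm_sq (n : ℕ) :
    ∫⁻ x : EuclideanSpace ℝ (Fin n), ENNReal.ofReal (Real.exp (-(1 / 2) * ‖x‖ ^ 2)) =
      ENNReal.ofReal (Real.sqrt ((2 * Real.pi) ^ n)) := by
  have h := GaussianFourier.integral_rexp_neg_mul_sq_norm (V := EuclideanSpace ℝ (Fin n))
    (b := 1 / 2) (by norm_num)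
  -- A nonzero Bochner integral certifies integrability, since the default value is 0.
  have hpos : 0 < ∫ x : EuclideanSpace ℝ (Fin n), Real.exp (-(1 / 2) * ‖x‖ ^ 2) := by
    rw [h]; positivity
  rw [← ofReal_integral_eq_lintegral_ofReal (not_imp_comm.1 integral_undef hpos.ne')
    (ae_of_all _ fun x => (Real.exp_pos _).le), h]
  congr 1
  rw [finrank_euclideanSpace, Fintype.card_fin, Real.sqrt_eq_rpow, ← Real.rpow_natCast,
    ← Real.rpow_mul (by positivity)]
  congr 1 <;> ring

theorem Matrix.PosDef.exists_transpose_mul_self {n : ℕ} {A : Matrix (Fin n) (Fin n) ℝ}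
    (hA : A.PosDef) : ∃ B : Matrix (Fin n) (Fin n) ℝ, A = Bᵀ * B := by
  refine ⟨CFC.sqrt A, ?_⟩
  have h0 : (0 : Matrix (Fin n) (Fin n) ℝ) ≤ A := hA.posSemidef.nonneg
  have h1 : (CFC.sqrt A)ᵀ = CFC.sqrt A := by
    have := (Matrix.nonneg_iff_posSemidef.1 (CFC.sqrt_nonneg A)).isHermitian
    rwa [Matrix.IsHermitian, Matrix.conjTranspose_eq_transpose_of_trivial] at this
  rw [h1, CFC.sqrt_mul_sqrt_self A h0]

/-- With `A = Bᵀ B` the quadratic form is `‖B x‖²`, and the substitution `y = B x` contributes `|det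
B|⁻¹ = (det A)^{-1/2}`. -/
theorem lintegral_exp_neg_half_quadratic {n : ℕ} {A : Matrix (Fin n) (Fin n) ℝ} (hA : A.PosDef) :
    ∫⁻ x : EuclideanSpace ℝ (Fin n),
        ENNReal.ofReal (Real.exp (-(1 / 2) * ((x : Fin n → ℝ) ⬝ᵥ A *ᵥ (x : Fin n → ℝ)))) =
      ENNReal.ofReal (Real.sqrt ((2 * Real.pi) ^ n / A.det)) := by
  obtain ⟨B, rfl⟩ := hA.exists_transpose_mul_self
  have hdet : (Bᵀ * B).det = B.det ^ 2 := by rw [Matrix.det_mul, Matrix.det_transpose, sq]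
  have hB : B.det ≠ 0 := by
    have := hA.det_pos
    rw [hdet] at this
    exact fun h => by simp [h] at this
  have hLdet : LinearMap.det (Matrix.toEuclideanLin B) = B.det := by
    rw [← LinearMap.det_toLin (PiLp.basisFun 2 ℝ (Fin n)) B]
    rfl
  have hq (x : EuclideanSpace ℝ (Fin n)) :
      ((x : Fin n → ℝ) ⬝ᵥ (Bᵀ * B) *ᵥ (x : Fin n → ℝ)) = ‖Matrix.toEuclideanLin B x‖ ^ 2 := by
    rw [EuclideanSpace.real_norm_sq_eq, ← Matrix.mulVec_mulVec, Matrix.dotProduct_mulVec,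
      Matrix.vecMul_transpose]
    simp [dotProduct, sq]
  have hmeas : Measurable (Matrix.toEuclideanLin B) :=
    (LinearMap.continuous_of_finiteDimensional _).measurable
  simp_rw [hq]
  rw [← lintegral_map (f := fun y : EuclideanSpace ℝ (Fin n) =>
      ENNReal.ofReal (Real.exp (-(1 / 2) * ‖y‖ ^ 2))) (by fun_prop) hmeas,
    Measure.map_linearMap_addHaar_eq_smul_addHaar _ (by rwa [hLdet]), lintegral_smul_measure,
    lintegral_exp_neg_half_norm_sq, hLdet, hdet, smul_eq_mul,
    ← ENNReal.ofReal_mul (abs_nonneg _), Real.sqrt_div (by positivity), Real.sqrt_sq_eq_abs,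
    abs_inv, div_eq_inv_mul]

theorem normalDensity_nonneg {n : ℕ} (t : Matrix (Fin n) (Fin n) ℝ)
    (x : EuclideanSpace ℝ (Fin n)) : 0 ≤ normalDensity t x := by
  unfold normalDensity; positivity

@[fun_prop]
theorem continuous_normalDensity {n : ℕ} (t : Matrix (Fin n) (Fin n) ℝ) :
    Continuous (normalDensity t) := by
  unfold normalDensity
  simp only [dotProduct, Matrix.mulVec]
  fun_prop

/-- The `L²` scalar product of two centered normal densities. -/
theorem lintegral_normalDensity_mul {n : ℕ} {s t : Matrix (Fin n) (Fin n) ℝ} (hs : s.PosDef)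
    (ht : t.PosDef) :
    ∫⁻ x, ENNReal.ofReal (normalDensity s x) * ENNReal.ofReal (normalDensity t x) =
      ENNReal.ofReal (1 / Real.sqrt ((2 * Real.pi) ^ n * (s + t).det)) := by
  have hA : (s⁻¹ + t⁻¹).PosDef := hs.inv.add ht.inv
  have hs0 := hs.det_pos
  have ht0 := ht.det_pos
  have hst := (hs.add ht).det_pos
  have hdet : (s⁻¹ + t⁻¹).det = (s + t).det / (s.det * t.det) := by
    have h : s⁻¹ + t⁻¹ = s⁻¹ * (s + t) * t⁻¹ := by
      rw [mul_add, add_mul, Matrix.nonsing_inv_mul _ hs0.ne'.isUnit, one_mul, mul_assoc,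
        Matrix.mul_nonsing_inv _ ht0.ne'.isUnit, mul_one, add_comm]
    rw [h, Matrix.det_mul, Matrix.det_mul, Matrix.det_nonsing_inv, Matrix.det_nonsing_inv,
      Ring.inverse_eq_inv']
    field_simp
  have hmul (x : EuclideanSpace ℝ (Fin n)) :
      ENNReal.ofReal (normalDensity s x) * ENNReal.ofReal (normalDensity t x) =
        ENNReal.ofReal (1 / Real.sqrt ((2 * Real.pi) ^ n * s.det) *
            (1 / Real.sqrt ((2 * Real.pi) ^ n * t.det))) *
          ENNReal.ofReal
            (Real.exp (-(1 / 2) * ((x : Fin n → ℝ) ⬝ᵥ (s⁻¹ + t⁻¹) *ᵥ (x : Fin n → ℝ)))) := by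
    rw [← ENNReal.ofReal_mul (normalDensity_nonneg s x), ← ENNReal.ofReal_mul (by positivity),
      Matrix.add_mulVec, dotProduct_add, mul_add, Real.exp_add]
    congr 1
    unfold normalDensity
    ring
  simp_rw [hmul]
  rw [lintegral_const_mul' _ _ ENNReal.ofReal_ne_top, lintegral_exp_neg_half_quadratic hA, hdet,
    ← ENNReal.ofReal_mul (by positivity)]
  congr 1
  have hp : (0 : ℝ) < (2 * Real.pi) ^ n := by positivity
  rw [Real.sqrt_mul hp.le, Real.sqrt_mul hp.le, Real.sqrt_mul hp.le, Real.sqrt_div hp.le,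
    Real.sqrt_div hst.le, Real.sqrt_mul hs0.le]
  have h1 := Real.sqrt_pos.2 hp
  have h2 := Real.sqrt_pos.2 hs0
  have h3 := Real.sqrt_pos.2 ht0
  have h4 := Real.sqrt_pos.2 hst
  field_simp

theorem Matrix.posDef_smul_one {n : ℕ} {c : ℝ} (hc : 0 < c) :
    (c • (1 : Matrix (Fin n) (Fin n) ℝ)).PosDef :=
  Matrix.PosDef.one.smul hc

theorem memLp_two_normalDensity {n : ℕ} {t : Matrix (Fin n) (Fin n) ℝ} (ht : t.PosDef) :
    MemLp (normalDensity t) 2 volume := by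
  refine ⟨(continuous_normalDensity t).aestronglyMeasurable, ?_⟩
  rw [eLpNorm_lt_top_iff_lintegral_rpow_enorm_lt_top two_ne_zero ENNReal.ofNat_ne_top]
  refine lt_of_eq_of_lt (lintegral_congr fun x => ?_)
    ((lintegral_normalDensity_mul ht ht).trans_lt ENNReal.ofReal_lt_top)
  rw [Real.enorm_eq_ofReal (normalDensity_nonneg t x)]
  simp [sq]

theorem integral_normalDensity_sq {n : ℕ} {t : Matrix (Fin n) (Fin n) ℝ} (ht : t.PosDef) :
    ∫ x, normalDensity t x ^ 2 = 1 / Real.sqrt ((2 * Real.pi) ^ n * (t + t).det) := by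
  rw [integral_eq_lintegral_of_nonneg_ae (ae_of_all _ fun x => sq_nonneg _)
    (by fun_prop)]
  simp_rw [sq, ENNReal.ofReal_mul (normalDensity_nonneg t _)]
  rw [lintegral_normalDensity_mul ht ht, ENNReal.toReal_ofReal (by positivity)]

/-! ### Isotropic normal laws and their mixtures. -/

theorem normalDensity_smul_one {n : ℕ} (l : ℝ) (x : EuclideanSpace ℝ (Fin n)) :
    normalDensity (l • (1 : Matrix (Fin n) (Fin n) ℝ)) x =
      1 / Real.sqrt ((2 * Real.pi) ^ n * l ^ n) * Real.exp (-(1 / (2 * l)) * ‖x‖ ^ 2) := by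
  have hinv : (l • (1 : Matrix (Fin n) (Fin n) ℝ))⁻¹ = l⁻¹ • 1 := by
    -- At `l = 0` both inverses default to 0, so the formula holds for every real `l` and yields
    -- joint measurability in `(l, x)`.
    rcases eq_or_ne l 0 with rfl | hl
    · simp
    · exact Matrix.inv_eq_left_inv (by simp [hl])
  rw [normalDensity, hinv, Matrix.det_smul, Matrix.det_one, mul_one, Fintype.card_fin,
    Matrix.smul_mulVec, Matrix.one_mulVec, dotProduct_smul, smul_eq_mul,
    EuclideanSpace.real_norm_sq_eq]
  congr 2
  simp only [dotProduct, sq]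
  field_simp

theorem measurable_normalDensity_smul_one (n : ℕ) :
    Measurable fun p : ℝ × EuclideanSpace ℝ (Fin n) =>
      normalDensity (p.1 • (1 : Matrix (Fin n) (Fin n) ℝ)) p.2 := by
  simp_rw [normalDensity_smul_one]
  fun_prop

theorem lintegral_normalDensity_smul_one {n : ℕ} {l : ℝ} (hl : 0 < l) :
    ∫⁻ x, ENNReal.ofReal (normalDensity (l • (1 : Matrix (Fin n) (Fin n) ℝ)) x) = 1 := by
  have hA := (Matrix.posDef_smul_one (n := n) hl).inv
  have hd := (Matrix.posDef_smul_one (n := n) hl).det_pos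
  simp_rw [normalDensity, ENNReal.ofReal_mul
    (show 0 ≤ 1 / Real.sqrt ((2 * Real.pi) ^ n * (l • (1 : Matrix (Fin n) (Fin n) ℝ)).det) by
      positivity)]
  rw [lintegral_const_mul' _ _ ENNReal.ofReal_ne_top, lintegral_exp_neg_half_quadratic hA,
    ← ENNReal.ofReal_mul (by positivity), Matrix.det_nonsing_inv, Ring.inverse_eq_inv',
    div_inv_eq_mul, one_div, inv_mul_cancel₀ (by positivity), ENNReal.ofReal_one]

/-- A centered Gaussian vector with covariance `l Iₙ` has the density `normalDensity (l • 1)`. -/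
theorem map_smul_stdGaussian {n : ℕ} {l : ℝ} (hl : 0 < l) :
    (stdGaussian (EuclideanSpace ℝ (Fin n))).map (fun z => Real.sqrt l • z) =
      volume.withDensity
        (fun x => ENNReal.ofReal (normalDensity (l • (1 : Matrix (Fin n) (Fin n) ℝ)) x)) := by
  have hfin : IsFiniteMeasure ((volume : Measure (EuclideanSpace ℝ (Fin n))).withDensity
      (fun x => ENNReal.ofReal (normalDensity (l • (1 : Matrix (Fin n) (Fin n) ℝ)) x))) :=
    isFiniteMeasure_withDensity (by simp [lintegral_normalDensity_smul_one hl])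
  -- Both measures are finite with characteristic function `exp (-l ‖w‖² / 2)`.
  apply Measure.ext_of_charFun
  ext w
  rw [charFun_map_smul, charFun_stdGaussian, charFun_apply,
    integral_withDensity_eq_integral_toReal_smul (by fun_prop)
      (ae_of_all _ fun x => ENNReal.ofReal_lt_top)]
  have hl' : (0 : ℝ) < 1 / (2 * l) := by positivity
  have hlc : (l : ℂ) ≠ 0 := by exact_mod_cast hl.ne'
  have hint (x : EuclideanSpace ℝ (Fin n)) :
      (ENNReal.ofReal (normalDensity (l • (1 : Matrix (Fin n) (Fin n) ℝ)) x)).toReal •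
          Complex.exp (inner ℝ x w * Complex.I) =
        ((1 / Real.sqrt ((2 * Real.pi) ^ n * l ^ n) : ℝ) : ℂ) *
          Complex.exp (-((1 / (2 * l) : ℝ) : ℂ) * ‖x‖ ^ 2 + Complex.I * inner ℝ w x) := by
    rw [ENNReal.toReal_ofReal (normalDensity_nonneg _ x), normalDensity_smul_one,
      Complex.exp_add, real_inner_comm, Complex.real_smul, mul_comm Complex.I]
    push_cast
    ring
  simp_rw [hint]
  rw [integral_const_mul, GaussianFourier.integral_cexp_neg_mul_sq_norm_add (by simpa using hl'),
    ← mul_assoc]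
  -- The normalizing constant cancels the factor `(π / b)^{n/2}` of the Gaussian Fourier integral,
  -- with `b = 1 / (2 l)`.
  have hone : ((1 / Real.sqrt ((2 * Real.pi) ^ n * l ^ n) : ℝ) : ℂ) *
      ((Real.pi : ℂ) / ((1 / (2 * l) : ℝ) : ℂ)) ^
        ((Module.finrank ℝ (EuclideanSpace ℝ (Fin n)) : ℂ) / 2) = 1 := by
    have : (Real.pi : ℂ) / ((1 / (2 * l) : ℝ) : ℂ) = ((2 * Real.pi * l : ℝ) : ℂ) := by
      push_cast; field_simp
    rw [this, finrank_euclideanSpace, Fintype.card_fin,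
      show ((n : ℂ) / 2) = ((n / 2 : ℝ) : ℂ) by push_cast; rfl,
      ← Complex.ofReal_cpow (by positivity), ← mul_pow, Real.sqrt_eq_rpow, ← Real.rpow_natCast,
      ← Real.rpow_mul (by positivity), mul_one_div, ← Complex.ofReal_mul, one_div,
      inv_mul_cancel₀ (by positivity), Complex.ofReal_one]
  rw [hone, one_mul, norm_smul, Real.norm_of_nonneg (Real.sqrt_nonneg l), Complex.ofReal_mul,
    mul_pow, ← Complex.ofReal_pow, Real.sq_sqrt hl.le, Complex.I_sq]
  congr 1
  push_cast
  field_simp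
  ring

/-- The density of the mixture of the laws `N(0, l Iₙ)`, where `l` has the law `μ`. -/
noncomputable def mixtureDensity (n : ℕ) (μ : Measure ℝ) (x : EuclideanSpace ℝ (Fin n)) : ENNReal :=
  ∫⁻ l, ENNReal.ofReal (normalDensity (l • (1 : Matrix (Fin n) (Fin n) ℝ)) x) ∂μ

@[fun_prop]
theorem measurable_mixtureDensity (n : ℕ) (μ : Measure ℝ) [SFinite μ] :
    Measurable (mixtureDensity n μ) :=
  (measurable_normalDensity_smul_one n).ennreal_ofReal.lintegral_prod_left'

theorem measurable_uncurry_normalDensity_smul_one (n : ℕ) :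
    Measurable (Function.uncurry fun (x : EuclideanSpace ℝ (Fin n)) (l : ℝ) =>
      ENNReal.ofReal (normalDensity (l • (1 : Matrix (Fin n) (Fin n) ℝ)) x)) := by
  simp only [Function.uncurry_def, normalDensity_smul_one]
  fun_prop

theorem map_prod_stdGaussian {n : ℕ} {μ : Measure ℝ} [SFinite μ] (hμ : ∀ᵐ l ∂μ, 0 < l) :
    (μ.prod (stdGaussian (EuclideanSpace ℝ (Fin n)))).map (fun p => Real.sqrt p.1 • p.2) =
      volume.withDensity (mixtureDensity n μ) := by
  have hm : Measurable fun p : ℝ × EuclideanSpace ℝ (Fin n) => Real.sqrt p.1 • p.2 := by fun_prop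
  ext s hs
  rw [Measure.map_apply hm hs, Measure.prod_apply (hm hs), withDensity_apply _ hs]
  unfold mixtureDensity
  rw [lintegral_lintegral_swap
    (measurable_uncurry_normalDensity_smul_one n).aemeasurable]
  refine lintegral_congr_ae (hμ.mono fun l hl => ?_)
  dsimp only
  rw [← withDensity_apply _ hs, ← map_smul_stdGaussian hl, Measure.map_apply (by fun_prop) hs]
  rfl

theorem lintegral_mixtureDensity_mul {n : ℕ} {μ : Measure ℝ} [SFinite μ] (hμ : ∀ᵐ l ∂μ, 0 < l)
    {t : Matrix (Fin n) (Fin n) ℝ} (ht : t.PosDef) :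
    ∫⁻ x, mixtureDensity n μ x * ENNReal.ofReal (normalDensity t x) =
      ∫⁻ l, ENNReal.ofReal (1 / Real.sqrt ((2 * Real.pi) ^ n *
        (l • (1 : Matrix (Fin n) (Fin n) ℝ) + t).det)) ∂μ := by
  unfold mixtureDensity
  simp_rw [← lintegral_mul_const' _ _ ENNReal.ofReal_ne_top]
  have hm : Measurable (Function.uncurry fun (x : EuclideanSpace ℝ (Fin n)) (l : ℝ) =>
      ENNReal.ofReal (normalDensity (l • (1 : Matrix (Fin n) (Fin n) ℝ)) x) *
        ENNReal.ofReal (normalDensity t x)) :=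
    (measurable_uncurry_normalDensity_smul_one n).mul
      ((continuous_normalDensity t).measurable.comp measurable_fst).ennreal_ofReal
  rw [lintegral_lintegral_swap hm.aemeasurable]
  exact lintegral_congr_ae (hμ.mono fun l hl =>
    lintegral_normalDensity_mul (Matrix.posDef_smul_one hl) ht)

/-- Expanding one factor of the square as a mixture reduces the integral to scalar products with
`N(0, l' Iₙ)`. -/
theorem lintegral_mixtureDensity_sq {n : ℕ} {μ : Measure ℝ} [SFinite μ] (hμ : ∀ᵐ l ∂μ, 0 < l) :
    ∫⁻ x, mixtureDensity n μ x ^ 2 =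
      ∫⁻ l', ∫⁻ l, ENNReal.ofReal (1 / Real.sqrt ((2 * Real.pi) ^ n * (l + l') ^ n)) ∂μ ∂μ := by
  have hm : Measurable (Function.uncurry fun (x : EuclideanSpace ℝ (Fin n)) (l' : ℝ) =>
      mixtureDensity n μ x *
        ENNReal.ofReal (normalDensity (l' • (1 : Matrix (Fin n) (Fin n) ℝ)) x)) :=
    ((measurable_mixtureDensity n μ).comp measurable_fst).mul
      (measurable_uncurry_normalDensity_smul_one n)
  calc ∫⁻ x, mixtureDensity n μ x ^ 2
      = ∫⁻ x, ∫⁻ l', mixtureDensity n μ x *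
          ENNReal.ofReal (normalDensity (l' • (1 : Matrix (Fin n) (Fin n) ℝ)) x) ∂μ := by
        refine lintegral_congr fun x => ?_
        rw [lintegral_const_mul _ (by
          exact ((measurable_normalDensity_smul_one n).comp
            measurable_prodMk_right).ennreal_ofReal),
          sq]
        rfl
    _ = ∫⁻ l', (∫⁻ x, mixtureDensity n μ x *
          ENNReal.ofReal (normalDensity (l' • (1 : Matrix (Fin n) (Fin n) ℝ)) x)) ∂μ :=
        lintegral_lintegral_swap hm.aemeasurable
    _ = _ := by
        refine lintegral_congr_ae (hμ.mono fun l' hl' => ?_)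
        dsimp only
        rw [lintegral_mixtureDensity_mul hμ (Matrix.posDef_smul_one hl')]
        simp_rw [← add_smul, Matrix.det_smul, Matrix.det_one, mul_one, Fintype.card_fin]

theorem one_div_sqrt_pow_eq_rpow (n : ℕ) {y : ℝ} (hy : 0 < y) :
    1 / Real.sqrt (y ^ n) = y ^ (-(n : ℝ) / 2) := by
  rw [Real.sqrt_eq_rpow, ← Real.rpow_natCast, ← Real.rpow_mul hy.le, one_div, ← Real.rpow_neg hy.le]
  congr 1
  ring

/-! ### The density of the random vector and its square integrability. -/

section RandomVariables

variable {Ω : Type*} [MeasurableSpace Ω] {P : Measure Ω} [IsProbabilityMeasure P] {n : ℕ}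

theorem lintegral_mixtureDensity_sq_lt_top {Λ Λ₁ : Ω → ℝ} (hpos : ∀ᵐ ω ∂P, 0 < Λ ω)
    (hident : IdentDistrib Λ Λ₁ P P) (hindep : IndepFun Λ Λ₁ P)
    (hfin : Integrable (fun ω => (Λ ω + Λ₁ ω) ^ (-(n : ℝ) / 2)) P) :
    ∫⁻ x, mixtureDensity n (P.map Λ) x ^ 2 < ⊤ := by
  have hΛ := hident.aemeasurable_fst
  have hΛ₁ := hident.aemeasurable_snd
  have : IsProbabilityMeasure (P.map Λ) := Measure.isProbabilityMeasure_map hΛ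
  have hμ : ∀ᵐ l ∂P.map Λ, 0 < l := (ae_map_iff hΛ measurableSet_Ioi).2 hpos
  have hpos₁ : ∀ᵐ ω ∂P, 0 < Λ₁ ω := by
    rw [hident.map_eq] at hμ
    exact (ae_map_iff hΛ₁ measurableSet_Ioi).1 hμ
  have hm : Measurable fun p : ℝ × ℝ =>
      ENNReal.ofReal (1 / Real.sqrt ((2 * Real.pi) ^ n * (p.1 + p.2) ^ n)) := by fun_prop
  rw [lintegral_mixtureDensity_sq hμ, ← lintegral_prod_symm' _ hm]
  -- The second factor becomes the law of `Λ₁`, so by independence `μ × μ` is the law of `(Λ, Λ₁)`.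
  nth_rewrite 2 [hident.map_eq]
  rw [← (indepFun_iff_map_prod_eq_prod_map_map hΛ hΛ₁).1 hindep,
    lintegral_map' hm.aemeasurable (hΛ.prodMk hΛ₁)]
  refine lt_of_le_of_lt (le_of_eq (lintegral_congr_ae ?_))
    (hfin.const_mul (1 / Real.sqrt ((2 * Real.pi) ^ n))).lintegral_lt_top
  filter_upwards [hpos, hpos₁] with ω h1 h2
  rw [← one_div_sqrt_pow_eq_rpow n (add_pos h1 h2), Real.sqrt_mul (by positivity),
    one_div_mul_one_div]

omit [IsProbabilityMeasure P] in
theorem mixtureVector_ae_eq {Λ : Ω → ℝ} (hpos : ∀ᵐ ω ∂P, 0 < Λ ω)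
    {V : Ω → Matrix (Fin n) (Fin n) ℝ} (hV : ∀ ω, V ω = Λ ω • (1 : Matrix (Fin n) (Fin n) ℝ))
    (Z : Ω → EuclideanSpace ℝ (Fin n)) :
    mixtureVector V Z =ᵐ[P] fun ω => Real.sqrt (Λ ω) • Z ω := by
  filter_upwards [hpos] with ω hω
  have hsqrt : CFC.sqrt (V ω) = Real.sqrt (Λ ω) • (1 : Matrix (Fin n) (Fin n) ℝ) := by
    refine CFC.sqrt_unique ?_ ?_
    · rw [hV, smul_mul_smul_comm, Real.mul_self_sqrt hω.le, one_mul]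
    · exact Matrix.nonneg_iff_posSemidef.2
        (Matrix.posDef_smul_one (Real.sqrt_pos.2 hω)).posSemidef
  simp [mixtureVector, hsqrt]

theorem map_mixtureVector {Λ : Ω → ℝ} (hΛ : AEMeasurable Λ P) (hpos : ∀ᵐ ω ∂P, 0 < Λ ω)
    {V : Ω → Matrix (Fin n) (Fin n) ℝ} (hV : ∀ ω, V ω = Λ ω • (1 : Matrix (Fin n) (Fin n) ℝ))
    {Z : Ω → EuclideanSpace ℝ (Fin n)}
    (hZ : HasLaw Z (stdGaussian (EuclideanSpace ℝ (Fin n))) P) (hΛZ : IndepFun Λ Z P) :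
    P.map (mixtureVector V Z) = volume.withDensity (mixtureDensity n (P.map Λ)) := by
  have : IsProbabilityMeasure (P.map Λ) := Measure.isProbabilityMeasure_map hΛ
  have hμ : ∀ᵐ l ∂P.map Λ, 0 < l := (ae_map_iff hΛ measurableSet_Ioi).2 hpos
  have hm : Measurable fun p : ℝ × EuclideanSpace ℝ (Fin n) => Real.sqrt p.1 • p.2 := by fun_prop
  rw [Measure.map_congr (mixtureVector_ae_eq hpos hV Z), ← map_prod_stdGaussian hμ, ← hZ.map_eq,
    ← (indepFun_iff_map_prod_eq_prod_map_map hΛ hZ.aemeasurable).1 hΛZ,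
    AEMeasurable.map_map_of_aemeasurable hm.aemeasurable (hΛ.prodMk hZ.aemeasurable)]
  rfl

theorem hasPDF_mixtureVector {Λ : Ω → ℝ} (hΛ : AEMeasurable Λ P) (hpos : ∀ᵐ ω ∂P, 0 < Λ ω)
    {V : Ω → Matrix (Fin n) (Fin n) ℝ} (hV : ∀ ω, V ω = Λ ω • (1 : Matrix (Fin n) (Fin n) ℝ))
    {Z : Ω → EuclideanSpace ℝ (Fin n)}
    (hZ : HasLaw Z (stdGaussian (EuclideanSpace ℝ (Fin n))) P) (hΛZ : IndepFun Λ Z P) :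
    HasPDF (mixtureVector V Z) P volume := by
  have : IsProbabilityMeasure (P.map Λ) := Measure.isProbabilityMeasure_map hΛ
  refine hasPDF_of_map_eq_withDensity
    (AEMeasurable.congr ?_ (mixtureVector_ae_eq hpos hV Z).symm) _
    (measurable_mixtureDensity n (P.map Λ)).aemeasurable
    (map_mixtureVector hΛ hpos hV hZ hΛZ)
  exact hΛ.sqrt.smul hZ.aemeasurable

theorem pdf_mixtureVector {Λ : Ω → ℝ} (hΛ : AEMeasurable Λ P) (hpos : ∀ᵐ ω ∂P, 0 < Λ ω)
    {V : Ω → Matrix (Fin n) (Fin n) ℝ} (hV : ∀ ω, V ω = Λ ω • (1 : Matrix (Fin n) (Fin n) ℝ))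
    {Z : Ω → EuclideanSpace ℝ (Fin n)}
    (hZ : HasLaw Z (stdGaussian (EuclideanSpace ℝ (Fin n))) P) (hΛZ : IndepFun Λ Z P) :
    pdf (mixtureVector V Z) P volume =ᵐ[volume] mixtureDensity n (P.map Λ) := by
  have : IsProbabilityMeasure (P.map Λ) := Measure.isProbabilityMeasure_map hΛ
  have := hasPDF_mixtureVector hΛ hpos hV hZ hΛZ
  exact (pdf.eq_of_map_eq_withDensity' _ (measurable_mixtureDensity n (P.map Λ)).aemeasurable).1
    (map_mixtureVector hΛ hpos hV hZ hΛZ)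

end RandomVariables

/-! ### Expansion of the squared distance. -/

/-- The squared distance expands into an explicit function of `t`. -/
theorem normalSqDist_eq {n : ℕ} {μ : Measure ℝ} [SFinite μ] (hμ : ∀ᵐ l ∂μ, 0 < l)
    {f : EuclideanSpace ℝ (Fin n) → ℝ} (hf : MemLp f 2 volume)
    (hfμ : ∀ᵐ x, ENNReal.ofReal (f x) = mixtureDensity n μ x) (hf0 : ∀ x, 0 ≤ f x)
    {t : Matrix (Fin n) (Fin n) ℝ} (ht : t.PosDef) :
    normalSqDist f t = (∫ x, f x ^ 2) +
      (1 / Real.sqrt ((2 * Real.pi) ^ n * (t + t).det) -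
        2 * ∫ l, 1 / Real.sqrt ((2 * Real.pi) ^ n *
          (l • (1 : Matrix (Fin n) (Fin n) ℝ) + t).det) ∂μ) := by
  have hφ := memLp_two_normalDensity ht
  have hcross : ∫ x, f x * normalDensity t x = ∫ l, 1 / Real.sqrt ((2 * Real.pi) ^ n *
          (l • (1 : Matrix (Fin n) (Fin n) ℝ) + t).det) ∂μ := by
    rw [integral_eq_lintegral_of_nonneg_ae
      (ae_of_all _ fun x => mul_nonneg (hf0 x) (normalDensity_nonneg t x))
      (hf.aestronglyMeasurable.mul hφ.aestronglyMeasurable),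
      integral_eq_lintegral_of_nonneg_ae (ae_of_all _ fun l => by positivity),
      ← lintegral_mixtureDensity_mul hμ ht]
    · congr 1
      refine lintegral_congr_ae (hfμ.mono fun x hx => ?_)
      dsimp only
      rw [ENNReal.ofReal_mul (hf0 x), hx]
    · have hdet : Continuous fun l : ℝ => (l • (1 : Matrix (Fin n) (Fin n) ℝ) + t).det :=
        Continuous.matrix_det (by fun_prop)
      have := hdet.measurable
      exact Measurable.aestronglyMeasurable (by fun_prop)
  have h1 : Integrable (fun x => f x ^ 2) := hf.integrable_sq
  have h2 : Integrable (fun x => normalDensity t x ^ 2) := hφ.integrable_sq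
  have h3 : Integrable (fun x => 2 * (f x * normalDensity t x)) :=
    (hf.integrable_mul hφ).const_mul 2
  have h4 : Integrable (fun x => normalDensity t x ^ 2 - 2 * (f x * normalDensity t x)) := h2.sub h3
  have hexp (x : EuclideanSpace ℝ (Fin n)) : (f x - normalDensity t x) ^ 2 =
      f x ^ 2 + (normalDensity t x ^ 2 - 2 * (f x * normalDensity t x)) := by ring
  unfold normalSqDist
  simp_rw [hexp]
  rw [integral_add h1 h4, integral_sub h2 h3,
    integral_const_mul, hcross, integral_normalDensity_sq ht]

theorem integral_lt_integral_of_ae_lt {α : Type*} [MeasurableSpace α] {μ : Measure α} [NeZero μ]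
    {f g : α → ℝ} (hf : Integrable f μ) (hg : Integrable g μ) (h : ∀ᵐ x ∂μ, f x < g x) :
    ∫ x, f x ∂μ < ∫ x, g x ∂μ := by
  rw [← sub_pos, ← integral_sub hg hf, integral_pos_iff_support_of_nonneg_ae
    (h.mono fun x hx => (sub_pos.2 hx).le) (hg.sub hf), pos_iff_ne_zero]
  intro h0
  obtain ⟨x, hx, hx'⟩ := ((measure_eq_zero_iff_ae_notMem.1 h0).and h).exists
  exact hx (sub_pos.2 hx').ne'

/-! ### Minimization over the scalar matrices. -/

section OneParameter

open Filter Topology Set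

variable {μ : Measure ℝ} [IsProbabilityMeasure μ]

theorem integrable_div_add_rpow (hμ : ∀ᵐ l ∂μ, 0 < l) {b : ℝ} (hb : 0 ≤ b) {g : ℝ} (hg : 0 < g) :
    Integrable (fun l => (g / (l + g)) ^ b) μ := by
  refine Integrable.of_bound (Measurable.aestronglyMeasurable (by fun_prop)) 1
    (hμ.mono fun l hl => ?_)
  rw [Real.norm_of_nonneg (by positivity)]
  exact Real.rpow_le_one (by positivity) (by rw [div_le_one (by positivity)]; linarith) hb

theorem integrable_add_rpow_neg (hμ : ∀ᵐ l ∂μ, 0 < l) {b : ℝ} (hb : 0 ≤ b) {g : ℝ} (hg : 0 < g) :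
    Integrable (fun l => (l + g) ^ (-b)) μ := by
  refine Integrable.of_bound (Measurable.aestronglyMeasurable (by fun_prop)) (g ^ (-b))
    (hμ.mono fun l hl => ?_)
  rw [Real.norm_of_nonneg (by positivity)]
  exact Real.rpow_le_rpow_of_nonpos hg (by linarith) (by linarith)

theorem strictMonoOn_integral_div_add_rpow (hμ : ∀ᵐ l ∂μ, 0 < l) {b : ℝ} (hb : 0 < b) :
    StrictMonoOn (fun g => ∫ l, (g / (l + g)) ^ b ∂μ) (Ioi 0) := by
  intro g (hg : 0 < g) h (hh : 0 < h) hgh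
  refine integral_lt_integral_of_ae_lt (integrable_div_add_rpow hμ hb.le hg)
    (integrable_div_add_rpow hμ hb.le hh) (hμ.mono fun l hl => ?_)
  refine Real.rpow_lt_rpow (by positivity) ?_ hb
  rw [div_lt_div_iff₀ (by positivity) (by positivity)]
  nlinarith

/-- Dominated convergence with bound 1, stated for a general filter to serve the limits at 0 and at
infinity as well as continuity. -/
theorem tendsto_integral_div_add_rpow (hμ : ∀ᵐ l ∂μ, 0 < l) {b : ℝ} (hb : 0 ≤ b)
    {F : Filter ℝ} [F.IsCountablyGenerated] (hF : ∀ᶠ g in F, 0 < g) {φ : ℝ → ℝ}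
    (hφ : ∀ l, 0 < l → Tendsto (fun g => (g / (l + g)) ^ b) F (𝓝 (φ l))) :
    Tendsto (fun g => ∫ l, (g / (l + g)) ^ b ∂μ) F (𝓝 (∫ l, φ l ∂μ)) := by
  refine tendsto_integral_filter_of_dominated_convergence (fun _ => 1) (Eventually.of_forall
    fun g => Measurable.aestronglyMeasurable (by fun_prop)) (hF.mono fun g hg => hμ.mono
    fun l hl => ?_) (integrable_const _) (hμ.mono hφ)
  rw [Real.norm_of_nonneg (by positivity)]
  exact Real.rpow_le_one (by positivity) (by rw [div_le_one (by positivity)]; linarith) hb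

theorem exists_integral_div_add_rpow_eq (hμ : ∀ᵐ l ∂μ, 0 < l) {b : ℝ} (hb : 0 < b) {c : ℝ}
    (hc0 : 0 < c) (hc1 : c < 1) : ∃ g, 0 < g ∧ ∫ l, (g / (l + g)) ^ b ∂μ = c := by
  have hlim0 : Tendsto (fun g => ∫ l, (g / (l + g)) ^ b ∂μ) (𝓝[>] 0) (𝓝 0) := by
    have := tendsto_integral_div_add_rpow (F := 𝓝[>] 0) (φ := fun _ => 0) hμ hb.le
      self_mem_nhdsWithin fun l hl => by
        have hc : ContinuousAt (fun g : ℝ => (g / (l + g)) ^ b) 0 :=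
          ContinuousAt.rpow_const (by fun_prop (disch := simp [hl.ne'])) (Or.inr hb.le)
        have := hc.tendsto
        simp only [zero_div, Real.zero_rpow hb.ne'] at this
        exact this.mono_left nhdsWithin_le_nhds
    simpa using this
  have hlim1 : Tendsto (fun g => ∫ l, (g / (l + g)) ^ b ∂μ) atTop (𝓝 1) := by
    have := tendsto_integral_div_add_rpow (F := atTop) (φ := fun _ => 1) hμ hb.le
      (eventually_gt_atTop 0) fun l hl => by
        have h1 : Tendsto (fun g : ℝ => 1 - l / (l + g)) atTop (𝓝 (1 - 0)) :=
          tendsto_const_nhds.sub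
            (tendsto_const_nhds.div_atTop (tendsto_atTop_add_const_left _ _ tendsto_id))
        have h2 := h1.rpow_const (p := b) (Or.inr hb.le)
        rw [sub_zero, Real.one_rpow] at h2
        refine h2.congr' ((eventually_gt_atTop 0).mono fun g hg => ?_)
        have : l + g ≠ 0 := by positivity
        congr 1
        field_simp
        ring
    simpa using this
  have hcont : ContinuousOn (fun g => ∫ l, (g / (l + g)) ^ b ∂μ) (Ioi 0) := by
    intro g (hg : 0 < g)
    refine (tendsto_integral_div_add_rpow hμ hb.le (lt_mem_nhds hg) fun l hl => ?_).mono_left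
      nhdsWithin_le_nhds
    exact ContinuousAt.rpow_const (by fun_prop (disch := positivity)) (Or.inr hb.le)
  obtain ⟨g₁, h₁, hg₁⟩ := ((hlim0.eventually_lt_const hc0).and self_mem_nhdsWithin).exists
  obtain ⟨g₂, h₂, hg₂⟩ := ((hlim1.eventually_const_lt hc1).and (eventually_gt_atTop 0)).exists
  obtain ⟨g, hg, h⟩ := isPreconnected_Ioi.intermediate_value hg₁ hg₂ hcont ⟨h₁.le, h₂.le⟩
  exact ⟨g, hg, h⟩

theorem hasDerivAt_integral_add_rpow_neg (hμ : ∀ᵐ l ∂μ, 0 < l) {a : ℝ} (ha : 0 < a) {g : ℝ}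
    (hg : 0 < g) :
    HasDerivAt (fun g => ∫ l, (l + g) ^ (-a) ∂μ) (∫ l, -a * (l + g) ^ (-a - 1) ∂μ) g := by
  refine (hasDerivAt_integral_of_dominated_loc_of_deriv_le (x₀ := g)
    (F := fun g l => (l + g) ^ (-a)) (F' := fun g l => -a * (l + g) ^ (-a - 1))
    -- Staying above `g / 2` bounds the derivative uniformly in `l > 0`.
    (s := Ioi (g / 2)) (bound := fun _ => a * (g / 2) ^ (-a - 1))
    (Ioi_mem_nhds (by linarith)) (Eventually.of_forall fun h =>
      Measurable.aestronglyMeasurable (by fun_prop)) (integrable_add_rpow_neg hμ ha.le hg)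
    (Measurable.aestronglyMeasurable (by fun_prop)) (hμ.mono fun l hl h (hh : g / 2 < h) => ?_)
    (integrable_const _) (hμ.mono fun l hl h (hh : g / 2 < h) => ?_)).2
  · have : 0 < l + h := by linarith
    rw [norm_mul, norm_neg, Real.norm_of_nonneg ha.le, Real.norm_of_nonneg (by positivity)]
    exact mul_le_mul_of_nonneg_left
      (Real.rpow_le_rpow_of_nonpos (by linarith) (by linarith) (by linarith)) ha.le
  · have : 0 < l + h := by linarith
    have := ((hasDerivAt_id h).const_add l).rpow_const (p := -a) (Or.inl this.ne')
    simpa using this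

/-- Up to an additive constant and a positive factor, the squared distance of the mixture to the
law `N(0, g Iₙ)`, with `a = n / 2`. -/
noncomputable def isotropicCost (μ : Measure ℝ) (a g : ℝ) : ℝ :=
  (2 * g) ^ (-a) - 2 * ∫ l, (l + g) ^ (-a) ∂μ

/-- Factoring out `g^{-a-1}` leaves a strictly increasing function of `g`, which alone decides the
sign. -/
theorem hasDerivAt_isotropicCost (hμ : ∀ᵐ l ∂μ, 0 < l) {a : ℝ} (ha : 0 < a) {g : ℝ}
    (hg : 0 < g) :
    HasDerivAt (isotropicCost μ a)
      (2 * a * g ^ (-a - 1) * (∫ l, (g / (l + g)) ^ (a + 1) ∂μ - 2 ^ (-a - 1))) g := by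
  have h1 := ((hasDerivAt_id g).const_mul 2).rpow_const (p := -a)
    (Or.inl (by simpa using hg.ne'))
  refine (h1.sub ((hasDerivAt_integral_add_rpow_neg hμ ha hg).const_mul 2)).congr_deriv ?_
  have h2 : ∫ l, (l + g) ^ (-a - 1) ∂μ = g ^ (-a - 1) * ∫ l, (g / (l + g)) ^ (a + 1) ∂μ := by
    rw [← integral_const_mul]
    refine integral_congr_ae (hμ.mono fun l hl => ?_)
    have hlg : 0 < l + g := by positivity
    dsimp only
    rw [Real.div_rpow hg.le hlg.le, show -a - 1 = -(a + 1) by ring, Real.rpow_neg hg.le,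
      Real.rpow_neg hlg.le]
    have := Real.rpow_pos_of_pos hg (a + 1)
    field_simp
  rw [integral_const_mul, h2, id, Real.mul_rpow two_pos.le hg.le]
  ring

theorem exists_isotropicCost_lt (hμ : ∀ᵐ l ∂μ, 0 < l) {a : ℝ} (ha : 0 < a) :
    ∃ g₀, 0 < g₀ ∧ ∀ g, 0 < g → g ≠ g₀ → isotropicCost μ a g₀ < isotropicCost μ a g := by
  have hb : 0 < a + 1 := by linarith
  obtain ⟨g₀, hg₀, h₀⟩ := exists_integral_div_add_rpow_eq hμ hb
    (c := 2 ^ (-a - 1)) (by positivity)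
    (Real.rpow_lt_one_of_one_lt_of_neg one_lt_two (by linarith))
  have hmono := strictMonoOn_integral_div_add_rpow hμ hb
  have hcont : ContinuousOn (isotropicCost μ a) (Ioi 0) := fun g hg =>
    (hasDerivAt_isotropicCost hμ ha hg).continuousAt.continuousWithinAt
  refine ⟨g₀, hg₀, fun g hg hne => ?_⟩
  have hfac (h : ℝ) (hh : 0 < h) : 0 < 2 * a * h ^ (-a - 1) := by positivity
  rcases hne.lt_or_gt with hlt | hlt
  · refine strictAntiOn_of_deriv_neg (convex_Icc g g₀)
      (hcont.mono fun x hx => hg.trans_le hx.1) (fun x hx => ?_)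
      (left_mem_Icc.2 hlt.le) (right_mem_Icc.2 hlt.le) hlt
    rw [interior_Icc] at hx
    have hx0 : 0 < x := hg.trans hx.1
    rw [(hasDerivAt_isotropicCost hμ ha hx0).deriv, ← h₀]
    exact mul_neg_of_pos_of_neg (hfac x hx0) (sub_neg.2 (hmono hx0 hg₀ hx.2))
  · refine strictMonoOn_of_deriv_pos (convex_Icc g₀ g)
      (hcont.mono fun x hx => hg₀.trans_le hx.1) (fun x hx => ?_)
      (left_mem_Icc.2 hlt.le) (right_mem_Icc.2 hlt.le) hlt
    rw [interior_Icc] at hx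
    have hx0 : 0 < x := hg₀.trans hx.1
    rw [(hasDerivAt_isotropicCost hμ ha hx0).deriv, ← h₀]
    exact mul_pos (hfac x hx0) (sub_pos.2 (hmono hg₀ hx0 hx.1))

end OneParameter

/-! ### The strict determinant inequality. -/

theorem strictConvexOn_log_add_exp {l : ℝ} (hl : 0 < l) :
    StrictConvexOn ℝ Set.univ fun u => Real.log (l + Real.exp u) := by
  have hd (u : ℝ) : HasDerivAt (fun u => Real.log (l + Real.exp u))
      (Real.exp u / (l + Real.exp u)) u :=
    ((Real.hasDerivAt_exp u).const_add l).log (by positivity)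
  refine StrictMono.strictConvexOn_univ_of_deriv
    (continuous_iff_continuousAt.2 fun u => (hd u).continuousAt) fun u v huv => ?_
  rw [(hd u).deriv, (hd v).deriv, div_lt_div_iff₀ (by positivity) (by positivity)]
  have := Real.exp_lt_exp.2 huv
  nlinarith

/-- Strict Jensen for `u ↦ log (l + exp u)` at the points `log (e i)` with equal weights; their mean
is `log g`. -/
theorem pow_add_geom_mean_lt_prod {n : ℕ} {e : Fin n → ℝ} (he : ∀ i, 0 < e i) {j k : Fin n}
    (hjk : e j ≠ e k) {g : ℝ} (hg : 0 < g) (hge : g ^ n = ∏ i, e i) {l : ℝ} (hl : 0 < l) :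
    (l + g) ^ n < ∏ i, (l + e i) := by
  have hn : (0 : ℝ) < n := by
    have := j.pos
    exact_mod_cast this
  have hJ := (strictConvexOn_log_add_exp hl).map_sum_lt (t := Finset.univ)
    (w := fun _ : Fin n => (n : ℝ)⁻¹) (p := fun i => Real.log (e i)) (fun _ _ => by positivity)
    (by simp [hn.ne']) (fun _ _ => Set.mem_univ _)
    ⟨j, Finset.mem_univ j, k, Finset.mem_univ k, fun h => hjk (Real.log_injOn_pos (he j) (he k) h)⟩
  have hmean : ∑ i, (n : ℝ)⁻¹ • Real.log (e i) = Real.log g := by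
    rw [← Finset.smul_sum, ← Real.log_prod fun i _ => (he i).ne', ← hge, Real.log_pow, smul_eq_mul,
      inv_mul_cancel_left₀ hn.ne']
  rw [hmean, Real.exp_log hg] at hJ
  simp_rw [fun i => Real.exp_log (he i)] at hJ
  rw [← Finset.smul_sum, ← Real.log_prod fun i _ => (add_pos hl (he i)).ne', smul_eq_mul,
    lt_inv_mul_iff₀ hn, ← Real.log_pow] at hJ
  exact (Real.log_lt_log_iff (by positivity)
    (Finset.prod_pos fun i _ => add_pos hl (he i))).1 hJ

/-- Up to the sign `(-1)ⁿ`, this is the characteristic polynomial evaluated at `-l`. -/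
theorem Matrix.IsHermitian.det_smul_one_add {n : ℕ} {t : Matrix (Fin n) (Fin n) ℝ}
    (ht : t.IsHermitian) (l : ℝ) :
    (l • (1 : Matrix (Fin n) (Fin n) ℝ) + t).det = ∏ i, (l + ht.eigenvalues i) := by
  have h := congrArg (Polynomial.eval (-l)) ht.charpoly_eq
  rw [Matrix.eval_charpoly, Polynomial.eval_prod] at h
  have h1 : l • (1 : Matrix (Fin n) (Fin n) ℝ) + t = -(Matrix.scalar (Fin n) (-l) - t) := by
    rw [Matrix.scalar_apply, ← Matrix.smul_one_eq_diagonal]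
    simp [add_comm]
  rw [h1, Matrix.det_neg, h, Fintype.card_fin]
  simp only [Polynomial.eval_sub, Polynomial.eval_X, Polynomial.eval_C, RCLike.ofReal_real_eq_id,
    id]
  have h2 (i : Fin n) : l + ht.eigenvalues i = -1 * (-l - ht.eigenvalues i) := by ring
  simp_rw [h2]
  rw [Finset.prod_mul_distrib]
  simp

theorem Matrix.IsHermitian.eq_smul_one_of_eigenvalues_eq {n : ℕ} {t : Matrix (Fin n) (Fin n) ℝ}
    (ht : t.IsHermitian) {c : ℝ} (h : ∀ i, ht.eigenvalues i = c) : t = c • 1 := by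
  have hdiag : Matrix.diagonal (RCLike.ofReal ∘ ht.eigenvalues) =
      c • (1 : Matrix (Fin n) (Fin n) ℝ) := by
    rw [Matrix.smul_one_eq_diagonal]
    congr 1
    ext i
    simp [h i]
  conv_lhs => rw [ht.spectral_theorem, hdiag]
  rw [map_smul, map_one]

/-- A strict form of Minkowski's determinant inequality. -/
theorem Matrix.PosDef.eq_smul_one_or_pow_lt_det {n : ℕ} (hn : 1 ≤ n)
    {t : Matrix (Fin n) (Fin n) ℝ} (ht : t.PosDef) :
    (∃ c : ℝ, 0 < c ∧ t = c • 1) ∨ ∃ g : ℝ, 0 < g ∧ t.det = g ^ n ∧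
      ∀ l : ℝ, 0 < l → (l + g) ^ n < (l • (1 : Matrix (Fin n) (Fin n) ℝ) + t).det := by
  have he := ht.eigenvalues_pos
  by_cases h : ∃ j k, ht.isHermitian.eigenvalues j ≠ ht.isHermitian.eigenvalues k
  · right
    obtain ⟨j, k, hjk⟩ := h
    have hg : (t.det ^ ((n : ℝ)⁻¹)) ^ n = t.det :=
      Real.rpow_inv_natCast_pow ht.det_pos.le (by lia)
    have hdet : t.det = ∏ i, ht.isHermitian.eigenvalues i := by
      simpa using ht.isHermitian.det_eq_prod_eigenvalues
    refine ⟨t.det ^ ((n : ℝ)⁻¹), Real.rpow_pos_of_pos ht.det_pos _, hg.symm, fun l hl => ?_⟩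
    rw [ht.isHermitian.det_smul_one_add]
    exact pow_add_geom_mean_lt_prod he hjk (Real.rpow_pos_of_pos ht.det_pos _)
      (hg.trans hdet) hl
  · left
    push Not at h
    exact ⟨_, he ⟨0, hn⟩, ht.isHermitian.eq_smul_one_of_eigenvalues_eq fun i => h i ⟨0, hn⟩⟩

/-! ### Minimization over all positive definite matrices. -/

/-- The part of the squared distance of the mixture to `N(0, t)` that depends on `t`. -/
noncomputable def matrixCost {n : ℕ} (μ : Measure ℝ) (t : Matrix (Fin n) (Fin n) ℝ) : ℝ :=
  1 / Real.sqrt ((2 * Real.pi) ^ n * (t + t).det) -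
    2 * ∫ l, 1 / Real.sqrt ((2 * Real.pi) ^ n *
      (l • (1 : Matrix (Fin n) (Fin n) ℝ) + t).det) ∂μ

theorem one_div_sqrt_mul_pow (n : ℕ) {y : ℝ} (hy : 0 < y) :
    1 / Real.sqrt ((2 * Real.pi) ^ n * y ^ n) =
      1 / Real.sqrt ((2 * Real.pi) ^ n) * y ^ (-((n : ℝ) / 2)) := by
  rw [← neg_div, ← one_div_sqrt_pow_eq_rpow n hy, Real.sqrt_mul (by positivity),
    one_div_mul_one_div]

section

variable {n : ℕ} {μ : Measure ℝ}

theorem isotropicCost_eq (hμ : ∀ᵐ l ∂μ, 0 < l) {g : ℝ} (hg : 0 < g) :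
    1 / Real.sqrt ((2 * Real.pi) ^ n) * isotropicCost μ ((n : ℝ) / 2) g =
      1 / Real.sqrt ((2 * Real.pi) ^ n * (2 * g) ^ n) -
        2 * ∫ l, 1 / Real.sqrt ((2 * Real.pi) ^ n * (l + g) ^ n) ∂μ := by
  have h : ∫ l, 1 / Real.sqrt ((2 * Real.pi) ^ n * (l + g) ^ n) ∂μ =
      1 / Real.sqrt ((2 * Real.pi) ^ n) * ∫ l, (l + g) ^ (-((n : ℝ) / 2)) ∂μ := by
    rw [← integral_const_mul]
    exact integral_congr_ae (hμ.mono fun l hl => one_div_sqrt_mul_pow n (add_pos hl hg))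
  rw [h, one_div_sqrt_mul_pow n (by positivity), isotropicCost]
  ring

theorem matrixCost_smul_one (hμ : ∀ᵐ l ∂μ, 0 < l) {g : ℝ} (hg : 0 < g) :
    matrixCost μ (g • (1 : Matrix (Fin n) (Fin n) ℝ)) =
      1 / Real.sqrt ((2 * Real.pi) ^ n) * isotropicCost μ ((n : ℝ) / 2) g := by
  rw [isotropicCost_eq hμ hg, matrixCost]
  simp_rw [← add_smul, Matrix.det_smul, Matrix.det_one, mul_one, Fintype.card_fin, two_mul]

/-- `t` and `g Iₙ` have equal determinants, hence equal first terms; the larger `det (l Iₙ + t)`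
makes the subtracted integral strictly smaller for `t`. -/
theorem isotropicCost_lt_matrixCost [IsProbabilityMeasure μ] (hμ : ∀ᵐ l ∂μ, 0 < l)
    {t : Matrix (Fin n) (Fin n) ℝ} {g : ℝ} (hg : 0 < g) (hdet : t.det = g ^ n)
    (hlt : ∀ l : ℝ, 0 < l → (l + g) ^ n < (l • (1 : Matrix (Fin n) (Fin n) ℝ) + t).det) :
    1 / Real.sqrt ((2 * Real.pi) ^ n) * isotropicCost μ ((n : ℝ) / 2) g < matrixCost μ t := by
  have hcont : Continuous fun l : ℝ => (l • (1 : Matrix (Fin n) (Fin n) ℝ) + t).det :=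
    Continuous.matrix_det (by fun_prop)
  have hmeas := hcont.measurable
  have hpt (l : ℝ) (hl : 0 < l) : 1 / Real.sqrt ((2 * Real.pi) ^ n *
      (l • (1 : Matrix (Fin n) (Fin n) ℝ) + t).det) <
        1 / Real.sqrt ((2 * Real.pi) ^ n * (l + g) ^ n) :=
    one_div_lt_one_div_of_lt (by positivity)
      (Real.sqrt_lt_sqrt (by positivity) (mul_lt_mul_of_pos_left (hlt l hl) (by positivity)))
  have hle (l : ℝ) (hl : 0 < l) : 1 / Real.sqrt ((2 * Real.pi) ^ n * (l + g) ^ n) ≤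
      1 / Real.sqrt ((2 * Real.pi) ^ n * g ^ n) :=
    one_div_le_one_div_of_le (by positivity) (by gcongr; linarith)
  have hint₁ : Integrable (fun l => 1 / Real.sqrt ((2 * Real.pi) ^ n * (l + g) ^ n)) μ := by
    refine Integrable.of_bound (Measurable.aestronglyMeasurable (by fun_prop))
      (1 / Real.sqrt ((2 * Real.pi) ^ n * g ^ n)) (hμ.mono fun l hl => ?_)
    rw [Real.norm_of_nonneg (by positivity)]
    exact hle l hl
  have hint₂ : Integrable (fun l => 1 / Real.sqrt ((2 * Real.pi) ^ n *
      (l • (1 : Matrix (Fin n) (Fin n) ℝ) + t).det)) μ := by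
    refine Integrable.of_bound (Measurable.aestronglyMeasurable (by fun_prop))
      (1 / Real.sqrt ((2 * Real.pi) ^ n * g ^ n)) (hμ.mono fun l hl => ?_)
    rw [Real.norm_of_nonneg (by positivity)]
    exact (hpt l hl).le.trans (hle l hl)
  have hI := integral_lt_integral_of_ae_lt hint₂ hint₁ (hμ.mono hpt)
  rw [isotropicCost_eq hμ hg, matrixCost, ← two_smul ℝ t, Matrix.det_smul, Fintype.card_fin, hdet,
    mul_pow 2 g]
  linarith

theorem exists_matrixCost_lt [IsProbabilityMeasure μ] (hn : 1 ≤ n) (hμ : ∀ᵐ l ∂μ, 0 < l) :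
    ∃ c : ℝ, 0 < c ∧ ∀ t : Matrix (Fin n) (Fin n) ℝ, t.PosDef → t ≠ c • 1 →
      matrixCost μ (c • (1 : Matrix (Fin n) (Fin n) ℝ)) < matrixCost μ t := by
  have hn0 : (0 : ℝ) < n := by exact_mod_cast hn
  obtain ⟨c, hc, hmin⟩ := exists_isotropicCost_lt hμ (half_pos hn0)
  have hC : 0 < 1 / Real.sqrt ((2 * Real.pi) ^ n) := by positivity
  refine ⟨c, hc, fun t ht hne => ?_⟩
  rw [matrixCost_smul_one hμ hc]
  rcases ht.eq_smul_one_or_pow_lt_det hn with ⟨g, hg, rfl⟩ | ⟨g, hg, hdet, hlt⟩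
  · rw [matrixCost_smul_one hμ hg]
    exact mul_lt_mul_of_pos_left (hmin g hg fun h => hne (by rw [h])) hC
  · refine lt_of_le_of_lt ?_ (isotropicCost_lt_matrixCost hμ hg hdet hlt)
    refine mul_le_mul_of_nonneg_left ?_ hC.le
    -- A non-scalar `t` may have `g = c`; strictness then comes from the determinant inequality
    -- alone.
    rcases eq_or_ne g c with rfl | h
    · exact le_rfl
    · exact (hmin g hg h).le

end

theorem proposition4p3 {Ω : Type*} [MeasurableSpace Ω] (P : Measure Ω) [IsProbabilityMeasure P]
    (n : ℕ) (hn : 1 ≤ n)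
    -- `Λ` is a positive random variable and `Λ₁` an independent copy of it
    (Λ Λ₁ : Ω → ℝ) (hpos : ∀ᵐ ω ∂P, 0 < Λ ω)
    (hident : IdentDistrib Λ Λ₁ P P) (hindep : IndepFun Λ Λ₁ P)
    (hfin : Integrable (fun ω => (Λ ω + Λ₁ ω) ^ (-(n : ℝ) / 2)) P)
    -- `V = Λ Iₙ`, and `Z` is a standard normal vector of `ℝⁿ`, independent of `Λ` (that is, of `V`)
    (V : Ω → Matrix (Fin n) (Fin n) ℝ)
    (hV : ∀ ω, V ω = Λ ω • (1 : Matrix (Fin n) (Fin n) ℝ))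
    (Z : Ω → EuclideanSpace ℝ (Fin n))
    (hZ : HasLaw Z (stdGaussian (EuclideanSpace ℝ (Fin n))) P)
    (hΛZ : IndepFun Λ Z P) :
    -- `V^{1/2} Z` has a density `f`, and `f` is in `L²(ℝⁿ)`
    HasPDF (mixtureVector V Z) P volume ∧
    MemLp (densityFun P (mixtureVector V Z)) 2 volume ∧
    -- `I` has exactly one minimizer on the positive definite matrices, a multiple of `Iₙ`
    ∃ t₀ : Matrix (Fin n) (Fin n) ℝ, t₀.PosDef ∧
      IsMinOn (normalSqDist (densityFun P (mixtureVector V Z))) {t | t.PosDef} t₀ ∧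
      (∀ t₁ : Matrix (Fin n) (Fin n) ℝ, t₁.PosDef →
        IsMinOn (normalSqDist (densityFun P (mixtureVector V Z))) {t | t.PosDef} t₁ → t₁ = t₀) ∧
      ∃ c : ℝ, 0 < c ∧ t₀ = c • (1 : Matrix (Fin n) (Fin n) ℝ) := by
  have hΛ := hident.aemeasurable_fst
  have : IsProbabilityMeasure (P.map Λ) := Measure.isProbabilityMeasure_map hΛ
  have hμ : ∀ᵐ l ∂P.map Λ, 0 < l := (ae_map_iff hΛ measurableSet_Ioi).2 hpos
  have hpdf := hasPDF_mixtureVector hΛ hpos hV hZ hΛZ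
  set f := densityFun P (mixtureVector V Z)
  have hf0 (x : EuclideanSpace ℝ (Fin n)) : 0 ≤ f x := ENNReal.toReal_nonneg
  have hfμ : ∀ᵐ x, ENNReal.ofReal (f x) = mixtureDensity n (P.map Λ) x :=
    -- The density is finite almost everywhere, so `toReal` loses nothing.
    pdf.ofReal_toReal_ae_eq.trans (pdf_mixtureVector hΛ hpos hV hZ hΛZ)
  have hf : MemLp f 2 volume := by
    refine ⟨(measurable_pdf _ P volume).ennreal_toReal.aestronglyMeasurable, ?_⟩
    rw [eLpNorm_lt_top_iff_lintegral_rpow_enorm_lt_top two_ne_zero ENNReal.ofNat_ne_top]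
    refine lt_of_eq_of_lt (lintegral_congr_ae (hfμ.mono fun x hx => ?_))
      (lintegral_mixtureDensity_sq_lt_top hpos hident hindep hfin)
    dsimp only
    rw [Real.enorm_eq_ofReal (hf0 x), hx]
    simp
  refine ⟨hpdf, hf, ?_⟩
  obtain ⟨c, hc, hmin⟩ := exists_matrixCost_lt hn hμ
  have hc' := Matrix.posDef_smul_one (n := n) hc
  have hlt (t : Matrix (Fin n) (Fin n) ℝ) (ht : t.PosDef) (hne : t ≠ c • 1) :
      normalSqDist f (c • (1 : Matrix (Fin n) (Fin n) ℝ)) < normalSqDist f t := by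
    rw [normalSqDist_eq hμ hf hfμ hf0 hc', normalSqDist_eq hμ hf hfμ hf0 ht]
    exact add_lt_add_right (hmin t ht hne) _
  refine ⟨c • 1, hc', fun t ht => ?_, fun t₁ ht₁ h₁ => ?_, c, hc, rfl⟩
  · rcases eq_or_ne t (c • 1) with rfl | hne
    · exact le_refl (normalSqDist f _)
    · exact (hlt t ht hne).le
  · by_contra hne
    exact (hlt t₁ ht₁ hne).not_ge (h₁ hc')
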